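/- For a code $C\subseteq\{0,1\}^n$ (linear or not) let $P_{\mathrm{ue}}(C,\varepsilon)=\frac1{|C|}\sum_{x\in C}\sum_{y\in C,\,y\ne x}\varepsilon^{|x-y|}(1-\varepsilon)^{n-|x-y|}$ be its undetected error probability over the binary symmetric channel with crossover probability $\varepsilon$, where $|x-y|$ is the Hamming distance: the average over the codewords $x$ of the probability that, when $x$ is sent, a codeword different from $x$ is received. (If $C$ is linear with $a_i$ codewords of weight $i$, this equals $\sum_{i=1}^n a_i\varepsilon^i(1-\varepsilon)^{n-i}$.) For a binary linear code $C$ of length $n$ and $T\subseteq\{1,\dots,n\}$ let $r_C(T)$ be the rank of the submatrix formed by the columns indexed by $T$ of a generating matrix of $C$. A family of binary linear codes $C_k$ of lengths $n_k\to\infty$ is called pseudorandom of rate $R$ if $\dim(C_k)/n_k\to R$ and $\mathbb E_{T}\big(|T|-r_{C_k}(T)\big)=o(n_k)$, where $T\subseteq\{1,\dots,n_k\}$ is random and contains each element independently with probability $R$ (that is, the codes achieve capacity on the binary erasure channel under bit-MAP decoding). Let $$\pi_{\mathrm{ue}}(R,\varepsilon)=\liminf_{n\to\infty}\Big(-\frac1n\log_2\min_C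 P_{\mathrm{ue}}(C,\varepsilon)\Big),$$ the minimum being over all codes $C\subseteq\{0,1\}^n$ with $|C|=\lceil 2^{Rn}\rceil$. **Corollary 1.5.** Let $0<\varepsilon<\frac12$ and $0<R<1$ with $1+\log_2(1-\varepsilon)\le R$. 1. For every pseudorandom family of linear codes $C_k$ of rate $R$ and every $\delta>0$, for all sufficiently large $k$ one has $P_{\mathrm{ue}}(C_k,\varepsilon)>0$ and $$-\frac1{n_k}\log_2 P_{\mathrm{ue}}(C_k,\varepsilon)\ \ge\ 1-R-\delta .$$ In fact $-\frac1{n_k}\log_2 P_{\mathrm{ue}}(C_k,\varepsilon)\to 1-R$ as $k\to\infty$. 2. This is the best possible exponent: $\pi_{\mathrm{ue}}(R,\varepsilon)=1-R$. 3. It is the same as that of random codes: for every $\delta>0$, with probability tending to $1$ as $n\to\infty$, $\big|-\frac1n\log_2 P_{\mathrm{ue}}(C,\varepsilon)-(1-R)\big|\le\delta$, where $C$ is either a uniformly random subset of $\{0,1\}^n$ of cardinality $\lceil 2^{Rn}\rceil$, or the linear code whose parity check matrix is a uniformly random binary matrix with $\lfloor(1-R)n\rfloor$ rows and $n$ columns.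 -/

import Mathlib

open Filter Topology Finset

noncomputable section

namespace BinaryCode

/-- The boolean cube of dimension `n`, as a vector space over the field with two elements. -/
abbrev Cube (n : ℕ) : Type := Fin n → ZMod 2

/-- A binary linear code of length `n`. -/
abbrev LinearCode (n : ℕ) : Type := Submodule (ZMod 2) (Cube n)

open Classical in
/-- The codewords of a linear code, as a finite subset of the cube. -/
def codewords {n : ℕ} (C : LinearCode n) : Finset (Cube n) :=
  Finset.univ.filter (fun x => x ∈ C)

/-- The rate `dim C / n` of a linear code. -/
def rate {n : ℕ} (C : LinearCode n) : ℝ :=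
  (Module.finrank (ZMod 2) C : ℝ) / n

/-- A generating matrix of `C`: its rows form a basis of `C`. -/
def generatingMatrix {n : ℕ} (C : LinearCode n) :
    Matrix (Fin (Module.finrank (ZMod 2) C)) (Fin n) (ZMod 2) :=
  Matrix.of fun i => (Module.finBasis (ZMod 2) C i : Cube n)

/-- `r_C(T)`: the rank of the columns indexed by `T` of a generating matrix of `C`. -/
def columnRank {n : ℕ} (C : LinearCode n) (T : Finset (Fin n)) : ℕ :=
  ((generatingMatrix C).submatrix id (fun j : {j // j ∈ T} => (j : Fin n))).rank

/-- For a matrix whose rows span `C`, the rank of the columns indexed by `T` is the dimension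
of the restriction of `C` to the coordinates in `T`. -/
theorem rank_columns_of_span_rows {n : ℕ} {ι : Type*} [Finite ι] (C : LinearCode n)
    (G : Matrix ι (Fin n) (ZMod 2)) (hG : Submodule.span (ZMod 2) (Set.range G.row) = C)
    (T : Finset (Fin n)) :
    (G.submatrix id (fun j : {j // j ∈ T} => (j : Fin n))).rank =
      Module.finrank (ZMod 2)
        (C.map (LinearMap.funLeft (ZMod 2) (ZMod 2) (fun j : {j // j ∈ T} => (j : Fin n)))) := by
  rw [Matrix.rank_eq_finrank_span_row, ← hG, Submodule.map_span, ← Set.range_comp]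
  rfl

/-- The rows of `generatingMatrix C` span `C`. -/
theorem span_rows_generatingMatrix {n : ℕ} (C : LinearCode n) :
    Submodule.span (ZMod 2) (Set.range (generatingMatrix C).row) = C := by
  have h : Set.range (generatingMatrix C).row
      = C.subtype '' Set.range (Module.finBasis (ZMod 2) C) := by
    rw [← Set.range_comp]; rfl
  rw [h, ← Submodule.map_span, (Module.finBasis (ZMod 2) C).span_eq]
  simp

/-- `r_C(T)` does not depend on the choice of the generating matrix. -/
theorem columnRank_eq_of_span_rows {n : ℕ} {ι : Type*} [Finite ι] (C : LinearCode n)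
    (G : Matrix ι (Fin n) (ZMod 2)) (hG : Submodule.span (ZMod 2) (Set.range G.row) = C)
    (T : Finset (Fin n)) :
    columnRank C T = (G.submatrix id (fun j : {j // j ∈ T} => (j : Fin n))).rank := by
  rw [rank_columns_of_span_rows C G hG, columnRank,
    rank_columns_of_span_rows C _ (span_rows_generatingMatrix C)]

/-- The expectation of `g T` for a random subset `T` of the `n` coordinates that contains each
coordinate independently with probability `p`. -/
def subsetExpectation {n : ℕ} (p : ℝ) (g : Finset (Fin n) → ℝ) : ℝ :=
  ∑ T : Finset (Fin n), p ^ T.card * (1 - p) ^ (n - T.card) * g T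

/-- A family of linear codes `C k` of lengths `n k` tending to infinity, whose rates tend to `R`
and which achieve capacity on the binary erasure channel under bit-MAP decoding:
`E_{T ∼ R} (|T| - r_C(T)) = o(n)`. -/
structure IsPseudorandom (R : ℝ) (n : ℕ → ℕ) (C : ∀ k, LinearCode (n k)) : Prop where
  length_tendsto : Tendsto n atTop atTop
  rate_tendsto : Tendsto (fun k => rate (C k)) atTop (𝓝 R)
  deficiency_isLittleO :
    (fun k => subsetExpectation R
      (fun T : Finset (Fin (n k)) => (T.card : ℝ) - (columnRank (C k) T : ℝ)))
      =o[atTop] (fun k => (n k : ℝ))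

/-- The probability that the word `x`, sent over the binary symmetric channel with crossover
probability `ε`, is received as `y`. -/
def bscProb {n : ℕ} (ε : ℝ) (x y : Cube n) : ℝ :=
  ε ^ hammingDist x y * (1 - ε) ^ (n - hammingDist x y)

/-- The undetected error probability of a (not necessarily linear) code: the average over the
sent codewords `x` of the probability that the received word is a codeword other than `x`. -/
def undetectedErrorProb {n : ℕ} (ε : ℝ) (C : Finset (Cube n)) : ℝ :=
  (1 / (C.card : ℝ)) * ∑ x ∈ C, ∑ y ∈ C.erase x, bscProb ε x y

/-- The undetected error exponent `-(1/n) log₂ P_ue(C, ε)`. -/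
def undetectedErrorExponent {n : ℕ} (ε : ℝ) (C : Finset (Cube n)) : ℝ :=
  -(1 / (n : ℝ)) * Real.logb 2 (undetectedErrorProb ε C)

/-- The codes of length `n` with exactly `⌈2 ^ (R n)⌉` codewords. -/
def codesOfRate (R : ℝ) (n : ℕ) : Finset (Finset (Cube n)) :=
  Finset.powersetCard ⌈(2 : ℝ) ^ (R * (n : ℝ))⌉₊ Finset.univ

/-- The smallest undetected error probability of a code of length `n` with `⌈2 ^ (R n)⌉`
codewords (the infimum is over a finite set, non-empty if `R ≤ 1`). -/
def minUndetectedErrorProb (R ε : ℝ) (n : ℕ) : ℝ :=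
  sInf ((undetectedErrorProb ε) '' (codesOfRate R n : Set (Finset (Cube n))))

/-- The best asymptotic undetected error exponent `π_ue(R, ε)` (the lower limit is taken in the
extended reals, where it always exists). -/
def bestUndetectedErrorExponent (R ε : ℝ) : EReal :=
  liminf (fun n : ℕ =>
    ((-(1 / (n : ℝ)) * Real.logb 2 (minUndetectedErrorProb R ε n) : ℝ) : EReal)) atTop

/-- The linear code with parity check matrix `M`. -/
def parityCheckCode {m n : ℕ} (M : Matrix (Fin m) (Fin n) (ZMod 2)) : LinearCode n :=
  LinearMap.ker M.mulVecLin

open Classical in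
/-- The probability of the property `p` for a uniformly random element of the finite set `s`. -/
def uniformProb {α : Type*} (s : Finset α) (p : α → Prop) : ℝ :=
  ((s.filter p).card : ℝ) / (s.card : ℝ)

end BinaryCode

end

/-! Up to a factor, the undetected error probability of a linear code is dominated by the density at
the origin of the channel output for a uniform codeword. `logb_relativeDensity_le` bounds the
logarithm of this density, relative to the uniform distribution, by the mean of `|T| - r_C(T)` over
`R`-random `T`. The proof adds one coordinate at a time. With `θ = 1 - 2ε` and `K` the subcode
vanishing at the new coordinate, the density becomes `θ D_K + (1 - θ) D_C`, where `D_C ≤ D_K ≤ 2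
D_C`. As `1 + θ ≤ 2 ^ R`, concavity of `x ↦ x ^ R` bounds its logarithm by `R log D_K + (1 - R) log
D_C`, which matches the recursion for the mean of `|T| - r_C(T)`. Pseudorandomness makes this mean
`o(n)`.

Conversely, `sq_card_div_le_sum` gives any nonempty code at least `|C| / 2 ^ n - (1 - ε) ^ n`. When
`1 + log₂ (1 - ε) = R` the two terms may cancel, so the bound is applied at a slightly larger `ε'`
and carried back at the cost of `(ε / ε') ^ n`.

For random codes the mean is at most a constant times `2 ^ (-(1 - R) n)`. Markov's inequality and
the converse pin down the exponent, and the minimum over codes is at most the mean. -/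

noncomputable section

namespace BinaryCode

variable {n : ℕ}

/-! ### The channel, coordinate by coordinate -/

/-- The transition probability of the binary symmetric channel restricted to the coordinates
in `S`. -/
def partialBscProb (S : Finset (Fin n)) (ε : ℝ) (x y : Cube n) : ℝ :=
  ∏ i ∈ S, if x i = y i then 1 - ε else ε

theorem bscProb_eq_partialBscProb (ε : ℝ) (x y : Cube n) :
    bscProb ε x y = partialBscProb univ ε x y := by
  have h := Finset.card_filter_add_card_filter_not (s := (univ : Finset (Fin n)))
    (fun i => x i = y i)
  rw [Finset.card_fin] at h
  rw [bscProb, partialBscProb, Finset.prod_ite, prod_const, prod_const, hammingDist, mul_comm]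
  simp only [ne_eq] at *
  congr 2
  omega

/-- The one-bit transition matrix is `ε` times the all-ones matrix plus `1 - 2ε` times the identity.
Every induction on coordinates rests on this splitting. -/
theorem partialBscProb_insert {S : Finset (Fin n)} {a : Fin n} (ha : a ∉ S) (ε : ℝ)
    (x y : Cube n) :
    partialBscProb (insert a S) ε x y =
      ε * partialBscProb S ε x y
        + (1 - 2 * ε) * (if x a = y a then partialBscProb S ε x y else 0) := by
  rw [partialBscProb, prod_insert ha, ← partialBscProb]
  split_ifs <;> ring

theorem partialBscProb_nonneg {ε : ℝ} (h0 : 0 ≤ ε) (h1 : ε ≤ 1) (S : Finset (Fin n))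
    (x y : Cube n) : 0 ≤ partialBscProb S ε x y :=
  prod_nonneg fun i _ => by split_ifs <;> linarith

theorem partialBscProb_pos {ε : ℝ} (h0 : 0 < ε) (h1 : ε < 1) (S : Finset (Fin n))
    (x y : Cube n) : 0 < partialBscProb S ε x y :=
  prod_pos fun i _ => by split_ifs <;> linarith

theorem partialBscProb_add_right (S : Finset (Fin n)) (ε : ℝ) (x y z : Cube n) :
    partialBscProb S ε (x + z) (y + z) = partialBscProb S ε x y := by
  simp [partialBscProb]

theorem bscProb_pos {ε : ℝ} (h0 : 0 < ε) (h1 : ε < 1) (x y : Cube n) : 0 < bscProb ε x y := by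
  rw [bscProb_eq_partialBscProb]; exact partialBscProb_pos h0 h1 _ _ _

/-! ### Shortened codes and column ranks -/

@[simp] theorem mem_codewords {C : LinearCode n} {x : Cube n} : x ∈ codewords C ↔ x ∈ C := by
  simp [codewords]

theorem zero_mem_codewords (C : LinearCode n) : (0 : Cube n) ∈ codewords C := by simp

theorem card_codewords (C : LinearCode n) :
    (codewords C).card = 2 ^ Module.finrank (ZMod 2) C := by
  classical
  have h := Module.card_eq_pow_finrank (K := ZMod 2) (V := C)
  rw [ZMod.card] at h
  rw [← h, Fintype.card_subtype, codewords]

/-- The subcode of the codewords that vanish on `T`. -/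
def shortening (C : LinearCode n) (T : Finset (Fin n)) : LinearCode n :=
  C ⊓ LinearMap.ker (LinearMap.funLeft (ZMod 2) (ZMod 2) (fun j : {j // j ∈ T} => (j : Fin n)))

theorem mem_shortening {C : LinearCode n} {T : Finset (Fin n)} {x : Cube n} :
    x ∈ shortening C T ↔ x ∈ C ∧ ∀ i ∈ T, x i = 0 := by
  simp [shortening, funext_iff, LinearMap.funLeft_apply]

/-- Rank-nullity for the restriction of `C` to `T`: the kernel is the shortened code. All rank
recursions are read off from it. -/
theorem columnRank_add_finrank_shortening (C : LinearCode n) (T : Finset (Fin n)) :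
    columnRank C T + Module.finrank (ZMod 2) (shortening C T)
      = Module.finrank (ZMod 2) C := by
  rw [columnRank_eq_of_span_rows C _ (span_rows_generatingMatrix C),
    rank_columns_of_span_rows C _ (span_rows_generatingMatrix C)]
  set f := LinearMap.funLeft (ZMod 2) (ZMod 2) (fun j : {j // j ∈ T} => (j : Fin n))
  have h := LinearMap.finrank_range_add_finrank_ker (f.domRestrict C)
  rw [← h, LinearMap.range_domRestrict, LinearMap.ker_domRestrict]
  congr 1
  exact (Submodule.equivSubtypeMap C _).finrank_eq.symm ▸ by
    rw [Submodule.map_comap_subtype]; rfl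

theorem columnRank_insert_of_forall_eq_zero {C : LinearCode n} {a : Fin n}
    (h : ∀ x ∈ C, x a = 0) (T : Finset (Fin n)) :
    columnRank C (insert a T) = columnRank C T := by
  have h1 := columnRank_add_finrank_shortening C (insert a T)
  have h2 := columnRank_add_finrank_shortening C T
  have : shortening C (insert a T) = shortening C T := by
    ext x
    simp only [mem_shortening, Finset.forall_mem_insert]
    exact ⟨fun hx => ⟨hx.1, hx.2.2⟩, fun hx => ⟨hx.1, h x hx.1, hx.2⟩⟩
  rw [this] at h1
  omega

theorem codewords_shortening_singleton (C : LinearCode n) (a : Fin n) :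
    codewords (shortening C {a}) = (codewords C).filter (fun x => x a = 0) := by
  ext x; simp [mem_shortening]

/-- The codewords with a given value of a coordinate form a coset of the shortened code. -/
theorem sum_codewords_filter_eq {C : LinearCode n} {u : Cube n} (hu : u ∈ C) (a : Fin n)
    (f : Cube n → ℝ) :
    ∑ x ∈ (codewords C).filter (fun x => x a = u a), f x
      = ∑ x ∈ codewords (shortening C {a}), f (x + u) := by
  symm
  refine Finset.sum_bij' (fun x _ => x + u) (fun x _ => x - u) ?_ ?_ ?_ ?_ ?_
  · intro x hx
    simp only [mem_codewords, mem_shortening, mem_singleton, forall_eq, mem_filter] at hx ⊢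
    exact ⟨C.add_mem hx.1 hu, by simp [hx.2]⟩
  · intro x hx
    simp only [mem_codewords, mem_shortening, mem_singleton, forall_eq, mem_filter] at hx ⊢
    exact ⟨C.sub_mem hx.1 hu, by simp [hx.2]⟩
  · intro x _; simp
  · intro x _; simp
  · intro x _; simp

/-- Splitting the sum over a code along a coordinate in which some codeword is non-zero. -/
theorem sum_codewords_eq_add {C : LinearCode n} {u : Cube n} (hu : u ∈ C) {a : Fin n}
    (hua : u a ≠ 0) (f : Cube n → ℝ) :
    ∑ x ∈ codewords C, f x = ∑ x ∈ codewords (shortening C {a}), f x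
      + ∑ x ∈ codewords (shortening C {a}), f (x + u) := by
  rw [← sum_filter_add_sum_filter_not (codewords C) (fun x => x a = 0),
    ← codewords_shortening_singleton, ← sum_codewords_filter_eq hu]
  congr 1
  refine Finset.sum_congr (Finset.filter_congr fun x _ => ?_) fun _ _ => rfl
  have key : ∀ s t : ZMod 2, t ≠ 0 → (¬ s = 0 ↔ s = t) := by decide
  exact key _ _ hua

theorem card_codewords_eq_two_mul {C : LinearCode n} {u : Cube n} (hu : u ∈ C) {a : Fin n}
    (hua : u a ≠ 0) :
    (codewords C).card = 2 * (codewords (shortening C {a})).card := by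
  have h := sum_codewords_eq_add hu hua (fun _ => 1)
  simp only [sum_const, nsmul_eq_mul, mul_one] at h
  rw [two_mul]
  exact_mod_cast h

theorem columnRank_insert_of_ne_zero {C : LinearCode n} {u : Cube n} (hu : u ∈ C) {a : Fin n}
    (hua : u a ≠ 0) (T : Finset (Fin n)) :
    columnRank C (insert a T) = columnRank (shortening C {a}) T + 1 := by
  have h1 := columnRank_add_finrank_shortening C (insert a T)
  have h2 := columnRank_add_finrank_shortening (shortening C {a}) T
  have h3 : shortening C (insert a T) = shortening (shortening C {a}) T := by
    ext x
    simp [mem_shortening, and_assoc]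
  have h4 := card_codewords_eq_two_mul hu hua
  rw [card_codewords, card_codewords, ← pow_succ'] at h4
  have h5 := Nat.pow_right_injective le_rfl h4
  rw [h3] at h1
  omega

theorem columnRank_empty (C : LinearCode n) : columnRank C ∅ = 0 := by
  have h := columnRank_add_finrank_shortening C ∅
  have : shortening C ∅ = C := by ext x; simp [mem_shortening]
  rw [this] at h
  omega

/-- The probability of landing in a translate of a linear code is largest for the code itself. -/
theorem sum_partialBscProb_le {ε : ℝ} (h0 : 0 ≤ ε) (h1 : ε ≤ 1 / 2) (S : Finset (Fin n)) :
    ∀ (C : LinearCode n) (v : Cube n),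
      ∑ x ∈ codewords C, partialBscProb S ε x v ≤ ∑ x ∈ codewords C, partialBscProb S ε x 0 := by
  induction S using Finset.induction_on with
  | empty => intro C v; simp [partialBscProb]
  | insert a S ha ih =>
    intro C v
    simp only [partialBscProb_insert ha, sum_add_distrib, ← mul_sum, ← sum_filter]
    have hθ : 0 ≤ 1 - 2 * ε := by linarith
    refine add_le_add (mul_le_mul_of_nonneg_left (ih C v) h0) (mul_le_mul_of_nonneg_left ?_ hθ)
    simp only [Pi.zero_apply]
    rw [← codewords_shortening_singleton]
    by_cases hu : ∃ u ∈ C, u a = v a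
    -- The codewords agreeing with `v` at `a` form the coset of the shortened code through `u`, so
    -- the induction hypothesis applies with target `v - u`.
    · obtain ⟨u, hu, hua⟩ := hu
      rw [← hua, sum_codewords_filter_eq hu]
      calc _ = ∑ x ∈ codewords (shortening C {a}), partialBscProb S ε x (v - u) :=
            sum_congr rfl fun x _ => by
              rw [← partialBscProb_add_right S ε x (v - u) u, sub_add_cancel]
        _ ≤ _ := ih _ _
    · push Not at hu
      rw [filter_eq_empty_iff.2 fun x hx => hu x (mem_codewords.1 hx), sum_empty]
      exact sum_nonneg fun x _ => partialBscProb_nonneg h0 (by linarith) _ _ _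

/-! ### Random subsets and the density inequality -/

/-- The expectation of `g T` for a random subset `T` of `S` that contains each element
independently with probability `p`. -/
def powersetExpectation (S : Finset (Fin n)) (p : ℝ) (g : Finset (Fin n) → ℝ) : ℝ :=
  ∑ T ∈ S.powerset, p ^ T.card * (1 - p) ^ (S.card - T.card) * g T

theorem powersetExpectation_univ (p : ℝ) (g : Finset (Fin n) → ℝ) :
    powersetExpectation univ p g = subsetExpectation p g := by
  simp [powersetExpectation, subsetExpectation]

/-- Condition on whether `a` is chosen. -/
theorem powersetExpectation_insert {S : Finset (Fin n)} {a : Fin n} (ha : a ∉ S) (p : ℝ)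
    (g : Finset (Fin n) → ℝ) :
    powersetExpectation (insert a S) p g = (1 - p) * powersetExpectation S p g
      + p * powersetExpectation S p (fun T => g (insert a T)) := by
  simp only [powersetExpectation]
  rw [sum_powerset_insert ha, mul_sum, mul_sum]
  congr 1 <;> refine sum_congr rfl fun T hT => ?_
  · have := card_le_card (mem_powerset.1 hT)
    rw [card_insert_of_notMem ha, Nat.succ_sub this, pow_succ]
    ring
  · rw [card_insert_of_notMem ha, card_insert_of_notMem fun h => ha (mem_powerset.1 hT h),
      Nat.add_sub_add_right]
    ring

theorem powersetExpectation_congr {S : Finset (Fin n)} {p : ℝ} {g h : Finset (Fin n) → ℝ}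
    (H : ∀ T ⊆ S, g T = h T) : powersetExpectation S p g = powersetExpectation S p h :=
  sum_congr rfl fun T hT => by rw [H T (mem_powerset.1 hT)]

theorem powersetExpectation_add_const (S : Finset (Fin n)) (p : ℝ) (g : Finset (Fin n) → ℝ)
    (c : ℝ) : powersetExpectation S p (fun T => g T + c) = powersetExpectation S p g + c := by
  have h := Finset.sum_pow_mul_eq_add_pow p (1 - p) S
  simp only [powersetExpectation, mul_add, sum_add_distrib, ← sum_mul]
  rw [h]; simp

/-- Two-point inequality: a consequence of the concavity of `x ↦ x ^ R`. -/
theorem logb_convexComb_le {R θ b k : ℝ} (hR : 0 ≤ R) (hR1 : R ≤ 1) (hθ : 0 ≤ θ)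
    (hθR : Real.logb 2 (1 + θ) ≤ R) (hb : 0 < b) (hbk : b ≤ k) (hkb : k ≤ 2 * b) :
    Real.logb 2 (θ * k + (1 - θ) * b) ≤ R * Real.logb 2 k + (1 - R) * Real.logb 2 b := by
  set ρ := k / b with hρ
  have hk : k = ρ * b := by rw [hρ]; field_simp
  have h1 : 1 ≤ ρ := by rw [hρ, le_div_iff₀ hb]; linarith
  have h2 : ρ ≤ 2 := by rw [hρ, div_le_iff₀ hb]; linarith
  have hρ0 : 0 < ρ := by linarith
  have hθ2 : 1 + θ ≤ (2 : ℝ) ^ R :=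
    (Real.logb_le_iff_le_rpow (by norm_num) (by linarith)).1 hθR
  -- On `[1, 2]` the concave function lies above its chord: `ρ ^ R ≥ 1 + (ρ - 1)(2 ^ R - 1) ≥ 1 + θ
  -- (ρ - 1)`.
  have hc := (Real.concaveOn_rpow hR hR1).2 (x := 1) (y := 2) (by simp) (by simp)
    (show 0 ≤ 2 - ρ by linarith) (show 0 ≤ ρ - 1 by linarith) (by ring)
  simp only [smul_eq_mul, Real.one_rpow] at hc
  have e : (2 - ρ) * 1 + (ρ - 1) * 2 = ρ := by ring
  rw [e] at hc
  have hpos : 0 < 1 + θ * (ρ - 1) := by nlinarith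
  have h3 : Real.logb 2 (1 + θ * (ρ - 1)) ≤ R * Real.logb 2 ρ := by
    rw [← Real.logb_rpow_eq_mul_logb_of_pos hρ0]
    exact Real.logb_le_logb_of_le (by norm_num) hpos (by nlinarith)
  have e2 : θ * k + (1 - θ) * b = (1 + θ * (ρ - 1)) * b := by rw [hk]; ring
  rw [e2, hk, Real.logb_mul hpos.ne' hb.ne', Real.logb_mul hρ0.ne' hb.ne']
  linarith

/-- The density of the output of the channel at the origin, for a uniformly random codeword,
relative to the uniform distribution (on the coordinates in `S`). -/
def relativeDensity (C : LinearCode n) (S : Finset (Fin n)) (ε : ℝ) : ℝ :=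
  2 ^ S.card / (codewords C).card * ∑ x ∈ codewords C, partialBscProb S ε x 0

theorem card_codewords_pos (C : LinearCode n) : (0 : ℝ) < (codewords C).card := by
  rw [card_codewords]; positivity

theorem sum_partialBscProb_pos {ε : ℝ} (h0 : 0 < ε) (h1 : ε < 1) (C : LinearCode n)
    (S : Finset (Fin n)) : 0 < ∑ x ∈ codewords C, partialBscProb S ε x 0 :=
  sum_pos (fun _ _ => partialBscProb_pos h0 h1 _ _ _) ⟨0, zero_mem_codewords C⟩

theorem relativeDensity_pos {ε : ℝ} (h0 : 0 < ε) (h1 : ε < 1) (C : LinearCode n)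
    (S : Finset (Fin n)) : 0 < relativeDensity C S ε :=
  mul_pos (div_pos (by positivity) (card_codewords_pos C)) (sum_partialBscProb_pos h0 h1 C S)

/-- Quantifying over all codes inside the induction on `S` is essential: the step for `C` uses the
hypothesis for both `C` and its shortening. -/
theorem logb_relativeDensity_le {ε R : ℝ} (h0 : 0 < ε) (h1 : ε ≤ 1 / 2) (hR : 0 ≤ R)
    (hR1 : R ≤ 1) (hεR : 1 + Real.logb 2 (1 - ε) ≤ R) (S : Finset (Fin n)) :
    ∀ C : LinearCode n, Real.logb 2 (relativeDensity C S ε)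
      ≤ powersetExpectation S R (fun T => (T.card : ℝ) - columnRank C T) := by
  have hε2 : 1 + Real.logb 2 (1 - ε) = Real.logb 2 (2 * (1 - ε)) := by
    rw [Real.logb_mul (by norm_num) (by linarith), Real.logb_self_eq_one (by norm_num)]
  induction S using Finset.induction_on with
  | empty =>
    intro C
    have := card_codewords_pos C
    simp [relativeDensity, powersetExpectation, partialBscProb, columnRank_empty, this.ne']
  | insert a S ha ih =>
    intro C
    have hpos := relativeDensity_pos h0 (by linarith : ε < 1) C S
    rw [powersetExpectation_insert ha]
    by_cases hu : ∃ u ∈ C, u a ≠ 0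
    · obtain ⟨u, hu, hua⟩ := hu
      set K := shortening C {a} with hK
      have hcard : ((codewords C).card : ℝ) = 2 * (codewords K).card := by
        exact_mod_cast card_codewords_eq_two_mul hu hua
      have hKpos := card_codewords_pos K
      have hsplit := sum_codewords_eq_add hu hua (fun x => partialBscProb S ε x 0)
      have hcoset : ∑ x ∈ codewords K, partialBscProb S ε (x + u) 0
          ≤ ∑ x ∈ codewords K, partialBscProb S ε x 0 := by
        refine le_trans (le_of_eq (sum_congr rfl fun x _ => ?_))
          (sum_partialBscProb_le h0.le h1 S K (-u))
        rw [← partialBscProb_add_right S ε x (-u) u, neg_add_cancel]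
      have hcoset0 : 0 ≤ ∑ x ∈ codewords K, partialBscProb S ε (x + u) 0 :=
        sum_nonneg fun x _ => partialBscProb_nonneg h0.le (by linarith) _ _ _
      -- `C` is the union of `K` and a coset of equal size, so its density is the average of theirs.
      -- The coset contributes at most as much as `K`, which gives this bound, and a nonnegative
      -- amount, which gives `hle2`.
      have hle : relativeDensity C S ε ≤ relativeDensity K S ε := by
        rw [relativeDensity, relativeDensity, hcard, hsplit, div_mul_eq_mul_div,
          div_mul_eq_mul_div, div_le_div_iff₀ (by positivity) hKpos]
        have : (0 : ℝ) ≤ 2 ^ S.card * (codewords K).card := by positivity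
        nlinarith [mul_le_mul_of_nonneg_left hcoset this]
      have hle2 : relativeDensity K S ε ≤ 2 * relativeDensity C S ε := by
        rw [relativeDensity, relativeDensity, hcard, hsplit, div_mul_eq_mul_div,
          div_mul_eq_mul_div, ← mul_div_assoc, div_le_div_iff₀ hKpos (by positivity)]
        have : (0 : ℝ) ≤ 2 ^ S.card * (codewords K).card := by positivity
        nlinarith [mul_nonneg this hcoset0]
      have hrec : relativeDensity C (insert a S) ε
          = (1 - 2 * ε) * relativeDensity K S ε
            + (1 - (1 - 2 * ε)) * relativeDensity C S ε := by
        simp only [relativeDensity, partialBscProb_insert ha, sum_add_distrib, ← mul_sum,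
          ← sum_filter, Pi.zero_apply]
        rw [← codewords_shortening_singleton, card_insert_of_notMem ha, hcard, ← hK]
        field_simp
        ring
      have hE : powersetExpectation S R
            (fun T => (((insert a T).card : ℕ) : ℝ) - columnRank C (insert a T))
          = powersetExpectation S R (fun T => (T.card : ℝ) - columnRank K T) := by
        refine powersetExpectation_congr fun T hT => ?_
        rw [columnRank_insert_of_ne_zero hu hua, card_insert_of_notMem fun h => ha (hT h)]
        push_cast
        ring
      rw [hrec, hE]
      refine (logb_convexComb_le hR hR1 (by linarith) ?_ hpos hle hle2).trans ?_
      · rw [hε2] at hεR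
        convert hεR using 2
        ring
      · have i1 := mul_le_mul_of_nonneg_left (ih K) hR
        have i2 := mul_le_mul_of_nonneg_left (ih C) (by linarith : 0 ≤ 1 - R)
        linarith
    -- A coordinate on which `C` vanishes multiplies the density by `2 (1 - ε)`, whose logarithm is
    -- at most `R`; the mean of `|T| - r_C(T)` grows by exactly `R`.
    · push Not at hu
      have hrec : relativeDensity C (insert a S) ε = 2 * (1 - ε) * relativeDensity C S ε := by
        simp only [relativeDensity, partialBscProb_insert ha, sum_add_distrib, ← mul_sum,
          ← sum_filter, Pi.zero_apply]
        rw [filter_true_of_mem fun x hx => hu x (mem_codewords.1 hx), card_insert_of_notMem ha]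
        ring
      have hE : powersetExpectation S R
            (fun T => (((insert a T).card : ℕ) : ℝ) - columnRank C (insert a T))
          = powersetExpectation S R (fun T => (T.card : ℝ) - columnRank C T) + 1 := by
        rw [← powersetExpectation_add_const]
        refine powersetExpectation_congr fun T hT => ?_
        rw [columnRank_insert_of_forall_eq_zero hu, card_insert_of_notMem fun h => ha (hT h)]
        push_cast
        ring
      rw [hrec, hE, Real.logb_mul (by linarith) hpos.ne', ← hε2]
      linarith [ih C]

/-! ### The converse bound for arbitrary codes -/

theorem sum_sum_ite_eq (C : Finset (Cube n)) (a : Fin n) (f : Cube n → Cube n → ℝ) :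
    ∑ x ∈ C, ∑ y ∈ C, (if x a = y a then f x y else 0)
      = ∑ x ∈ C with x a = 0, ∑ y ∈ C with y a = 0, f x y
        + ∑ x ∈ C with ¬ x a = 0, ∑ y ∈ C with ¬ y a = 0, f x y := by
  have key : ∀ s t : ZMod 2, ¬ s = 0 → (s = t ↔ ¬ t = 0) := by decide
  rw [← sum_filter_add_sum_filter_not C (fun x => x a = 0)]
  congr 1 <;> refine sum_congr rfl fun x hx => ?_ <;> rw [← sum_filter] <;>
    refine sum_congr (filter_congr fun y _ => ?_) fun _ _ => rfl
  · rw [(mem_filter.1 hx).2]; exact eq_comm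
  · exact key _ _ (mem_filter.1 hx).2

/-- Splitting `C` by the new bit into halves of sizes `u` and `v`, the induction step reduces to `(u
+ v) ^ 2 ≤ 2 (u ^ 2 + v ^ 2)`, weighted by `1 - 2ε ≥ 0`. -/
theorem sq_card_div_le_sum {ε : ℝ} (h0 : 0 ≤ ε) (h1 : ε ≤ 1 / 2) (S : Finset (Fin n)) :
    ∀ C : Finset (Cube n),
      (C.card : ℝ) ^ 2 / 2 ^ S.card ≤ ∑ x ∈ C, ∑ y ∈ C, partialBscProb S ε x y := by
  induction S using Finset.induction_on with
  | empty => intro C; simp [partialBscProb, sq]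
  | insert a S ha ih =>
    intro C
    simp only [partialBscProb_insert ha, sum_add_distrib, ← mul_sum]
    rw [sum_sum_ite_eq, card_insert_of_notMem ha]
    have hc : (C.card : ℝ) = (C.filter (fun x => x a = 0)).card
        + (C.filter (fun x => ¬ x a = 0)).card := by
      exact_mod_cast (card_filter_add_card_filter_not (s := C) (fun x => x a = 0)).symm
    have i0 := ih (C.filter (fun x => x a = 0))
    have i1 := ih (C.filter (fun x => ¬ x a = 0))
    have i := ih C
    have hθ : 0 ≤ 1 - 2 * ε := by linarith
    refine le_trans ?_ (add_le_add (mul_le_mul_of_nonneg_left i h0)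
      (mul_le_mul_of_nonneg_left (add_le_add i0 i1) hθ))
    rw [← add_div, ← mul_div_assoc, ← mul_div_assoc, ← add_div, pow_succ (2 : ℝ),
      div_le_div_iff₀ (by positivity) (by positivity)]
    have h2 : (0 : ℝ) < 2 ^ S.card := by positivity
    rw [hc]
    generalize Nat.cast (R := ℝ) (C.filter (fun x => x a = 0)).card = u
    generalize Nat.cast (R := ℝ) (C.filter (fun x => ¬ x a = 0)).card = v
    have : 0 ≤ (1 - 2 * ε) * (u - v) ^ 2 * 2 ^ S.card := by positivity
    nlinarith

theorem bscProb_self (ε : ℝ) (x : Cube n) : bscProb ε x x = (1 - ε) ^ n := by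
  simp [bscProb]

theorem undetectedErrorProb_eq_sub (ε : ℝ) {C : Finset (Cube n)} (hC : C.Nonempty) :
    undetectedErrorProb ε C
      = (1 / (C.card : ℝ)) * (∑ x ∈ C, ∑ y ∈ C, bscProb ε x y) - (1 - ε) ^ n := by
  have hc : (C.card : ℝ) ≠ 0 := by exact_mod_cast hC.card_pos.ne'
  have : ∀ x ∈ C, ∑ y ∈ C.erase x, bscProb ε x y
      = ∑ y ∈ C, bscProb ε x y - (1 - ε) ^ n := fun x hx => by
    rw [← sum_erase_add C _ hx, bscProb_self]; ring
  rw [undetectedErrorProb, sum_congr rfl this, sum_sub_distrib, sum_const, nsmul_eq_mul]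
  field_simp

theorem card_div_sub_le_undetectedErrorProb {ε : ℝ} (h0 : 0 ≤ ε) (h1 : ε ≤ 1 / 2)
    {C : Finset (Cube n)} (hC : C.Nonempty) :
    (C.card : ℝ) / 2 ^ n - (1 - ε) ^ n ≤ undetectedErrorProb ε C := by
  have hc : (0 : ℝ) < C.card := by exact_mod_cast hC.card_pos
  have h := sq_card_div_le_sum h0 h1 univ C
  rw [Finset.card_fin] at h
  rw [undetectedErrorProb_eq_sub ε hC]
  simp only [bscProb_eq_partialBscProb]
  have h' := mul_le_mul_of_nonneg_left h (by positivity : 0 ≤ 1 / (C.card : ℝ))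
  have e : 1 / (C.card : ℝ) * ((C.card : ℝ) ^ 2 / 2 ^ n) = C.card / 2 ^ n := by
    field_simp
  linarith

theorem undetectedErrorProb_nonneg {ε : ℝ} (h0 : 0 < ε) (h1 : ε < 1) (C : Finset (Cube n)) :
    0 ≤ undetectedErrorProb ε C :=
  mul_nonneg (by positivity)
    (sum_nonneg fun _ _ => sum_nonneg fun _ _ => (bscProb_pos h0 h1 _ _).le)

/-- Compare factor by factor: a flipped bit changes by exactly `ε / ε'`, and an unflipped bit is
only likelier at the smaller `ε`. -/
theorem bscProb_scale_le {ε ε' : ℝ} (h0 : 0 < ε) (hle : ε ≤ ε') (h1 : ε' ≤ 1)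
    (x y : Cube n) : (ε / ε') ^ n * bscProb ε' x y ≤ bscProb ε x y := by
  have hε' : 0 < ε' := h0.trans_le hle
  rw [bscProb_eq_partialBscProb, bscProb_eq_partialBscProb, partialBscProb, partialBscProb]
  have : (ε / ε') ^ n = ∏ _i : Fin n, ε / ε' := (Fin.prod_const n _).symm
  rw [this, ← prod_mul_distrib]
  have hq : ε / ε' ≤ 1 := (div_le_one hε').2 hle
  refine prod_le_prod (fun i _ => ?_) (fun i _ => ?_)
  · have : 0 ≤ 1 - ε' := by linarith
    split_ifs <;> positivity
  · split_ifs
    · nlinarith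
    · field_simp; exact le_rfl

theorem undetectedErrorProb_scale_le {ε ε' : ℝ} (h0 : 0 < ε) (hle : ε ≤ ε') (h1 : ε' ≤ 1)
    (C : Finset (Cube n)) :
    (ε / ε') ^ n * undetectedErrorProb ε' C ≤ undetectedErrorProb ε C := by
  rw [undetectedErrorProb, undetectedErrorProb, mul_left_comm]
  refine mul_le_mul_of_nonneg_left ?_ (by positivity)
  simp only [mul_sum]
  exact sum_le_sum fun x _ => sum_le_sum fun y _ => bscProb_scale_le h0 hle h1 x y

theorem undetectedErrorExponent_le_of_le {ε b : ℝ} (hn : 0 < n) {C : Finset (Cube n)}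
    (h : (2 : ℝ) ^ (-(b * n)) ≤ undetectedErrorProb ε C) : undetectedErrorExponent ε C ≤ b := by
  have hn' : (0 : ℝ) < n := by exact_mod_cast hn
  have hl : -(b * n) ≤ Real.logb 2 (undetectedErrorProb ε C) :=
    (Real.le_logb_iff_rpow_le (by norm_num)
      ((Real.rpow_pos_of_pos (by norm_num) _).trans_le h)).2 h
  rw [undetectedErrorExponent, neg_mul, neg_le, one_div, ← div_eq_inv_mul, le_div_iff₀ hn']
  linarith

theorem neg_inv_mul_logb_ge_of_le {b P : ℝ} (hn : 0 < n) (hP : 0 < P)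
    (h : P ≤ (2 : ℝ) ^ (-(b * n))) : b ≤ -(1 / (n : ℝ)) * Real.logb 2 P := by
  have hn' : (0 : ℝ) < n := by exact_mod_cast hn
  have hl : Real.logb 2 P ≤ -(b * n) :=
    (Real.logb_le_iff_le_rpow (by norm_num) hP).2 h
  rw [neg_mul, le_neg, one_div, ← div_eq_inv_mul, div_le_iff₀ hn']
  linarith

/-- The converse bound: the undetected error exponent of a code of rate `R` is at most `1 - R`,
up to lower order terms. -/
theorem exists_eventually_undetectedErrorExponent_le {ε R : ℝ} (h0 : 0 < ε) (h1 : ε < 1 / 2)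
    (hεR : 1 + Real.logb 2 (1 - ε) ≤ R) {η : ℝ} (hη : 0 < η) :
    ∃ δ : ℝ, 0 < δ ∧ ∀ᶠ n : ℕ in atTop, ∀ C : Finset (Cube n),
      (2 : ℝ) ^ ((R - δ) * n) ≤ C.card →
        0 < undetectedErrorProb ε C ∧ undetectedErrorExponent ε C ≤ 1 - R + η := by
  obtain ⟨ε', hlt, hhalf, hratio⟩ :
      ∃ ε' : ℝ, ε < ε' ∧ ε' < 1 / 2 ∧ (2 : ℝ) ^ (-(η / 3)) ≤ ε / ε' := by
    have hp : (1 : ℝ) < 2 ^ (η / 3) := Real.one_lt_rpow (by norm_num) (by positivity)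
    refine ⟨min (ε * 2 ^ (η / 3)) ((ε + 1 / 2) / 2), lt_min (by nlinarith) (by linarith),
      (min_le_right _ _).trans_lt (by linarith), ?_⟩
    have hm : 0 < min (ε * 2 ^ (η / 3)) ((ε + 1 / 2) / 2) := lt_min (by positivity) (by linarith)
    rw [le_div_iff₀ hm, Real.rpow_neg (by norm_num), ← div_eq_inv_mul,
      div_le_iff₀ (by positivity)]
    exact min_le_left _ _
  have hε' : 0 < ε' := h0.trans hlt
  set L := R - 1 - Real.logb 2 (1 - ε') with hL
  -- This is where moving to `ε' > ε` pays: the slack is strictly positive even when the hypothesis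
  -- on `R` is an equality.
  have hLpos : 0 < L := by
    have : Real.logb 2 (1 - ε') < Real.logb 2 (1 - ε) :=
      Real.logb_lt_logb (by norm_num) (by linarith) (by linarith)
    linarith
  have hLε : 1 - ε' = (2 : ℝ) ^ (R - 1 - L) := by
    rw [hL, sub_sub_cancel, Real.rpow_logb (by norm_num) (by norm_num) (by linarith)]
  -- Since `L ≥ 2δ` and `nδ ≥ 1`, the subtracted `(1 - ε') ^ n` is at most half of the main term.
  -- The loss `η` is split among the change of channel, the rate defect `δ`, and this factor `1 /
  -- 2`.
  refine ⟨min (L / 2) (η / 3), by positivity, ?_⟩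
  set δ := min (L / 2) (η / 3)
  have hδ : 0 < δ := by positivity
  have hδL : δ ≤ L / 2 := min_le_left _ _
  have hδη : δ ≤ η / 3 := min_le_right _ _
  filter_upwards [tendsto_natCast_atTop_atTop.eventually_ge_atTop (1 / δ), eventually_gt_atTop 0]
    with n hn hnpos C hC
  have hnδ : 1 ≤ n * δ := by rwa [div_le_iff₀ hδ] at hn
  have hn0 : (0 : ℝ) < n := by exact_mod_cast hnpos
  have hCpos : (0 : ℝ) < C.card := (Real.rpow_pos_of_pos (by norm_num) _).trans_le hC
  have hCne : C.Nonempty := card_pos.1 (by exact_mod_cast hCpos)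
  have hlow : (2 : ℝ) ^ ((R - 1 - δ) * n - 1) ≤ undetectedErrorProb ε' C := by
    refine le_trans ?_ (card_div_sub_le_undetectedErrorProb hε'.le hhalf.le hCne)
    have e1 : (2 : ℝ) ^ ((R - 1 - δ) * n) ≤ C.card / 2 ^ n := by
      rw [le_div_iff₀ (by positivity), ← Real.rpow_natCast, ← Real.rpow_add (by norm_num)]
      refine le_trans (le_of_eq ?_) hC
      congr 1; ring
    have e2 : (1 - ε') ^ n ≤ (2 : ℝ) ^ ((R - 1 - δ) * n - 1) := by
      rw [hLε, ← Real.rpow_natCast, ← Real.rpow_mul (by norm_num)]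
      refine Real.rpow_le_rpow_of_exponent_le (by norm_num) ?_
      nlinarith
    have e3 : (2 : ℝ) ^ ((R - 1 - δ) * n) = 2 * 2 ^ ((R - 1 - δ) * n - 1) := by
      rw [Real.rpow_sub (by norm_num), Real.rpow_one]; ring
    linarith
  have hfin : (2 : ℝ) ^ (-((1 - R + η) * n)) ≤ undetectedErrorProb ε C := by
    refine le_trans ?_ (undetectedErrorProb_scale_le h0 hlt.le (by linarith) C)
    have hq : (2 : ℝ) ^ (-(η / 3) * n) ≤ (ε / ε') ^ n := by
      rw [Real.rpow_mul (by norm_num), Real.rpow_natCast]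
      exact pow_le_pow_left₀ (by positivity) hratio n
    refine le_trans ?_ (mul_le_mul hq hlow (by positivity) (by positivity))
    rw [← Real.rpow_add (by norm_num)]
    refine Real.rpow_le_rpow_of_exponent_le (by norm_num) ?_
    nlinarith [mul_le_mul_of_nonneg_right hδη hn0.le]
  exact ⟨(Real.rpow_pos_of_pos (by norm_num) _).trans_le hfin,
    undetectedErrorExponent_le_of_le hnpos hfin⟩

/-! ### The exponent of pseudorandom codes -/

theorem undetectedErrorProb_codewords (ε : ℝ) (C : LinearCode n) :
    undetectedErrorProb ε (codewords C)
      = ∑ c ∈ (codewords C).erase 0, partialBscProb univ ε c 0 := by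
  have h : ∀ x ∈ codewords C, ∑ y ∈ (codewords C).erase x, bscProb ε x y
      = ∑ c ∈ (codewords C).erase 0, partialBscProb univ ε c 0 := by
    intro x hx
    rw [mem_codewords] at hx
    refine sum_bij' (fun y _ => x - y) (fun c _ => x - c) ?_ ?_ ?_ ?_ ?_
    · intro y hy
      simp only [mem_erase, mem_codewords] at hy ⊢
      exact ⟨sub_ne_zero.2 hy.1.symm, C.sub_mem hx hy.2⟩
    · intro c hc
      simp only [mem_erase, mem_codewords] at hc ⊢
      exact ⟨fun h => hc.1 (sub_eq_self.1 h), C.sub_mem hx hc.2⟩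
    · intro y _; simp
    · intro c _; simp
    · intro y _
      rw [bscProb_eq_partialBscProb, ← partialBscProb_add_right univ ε (x - y) 0 y]
      simp
  have hc := card_codewords_pos C
  rw [undetectedErrorProb, sum_congr rfl h, sum_const, nsmul_eq_mul]
  field_simp

theorem logb_undetectedErrorProb_le {ε R : ℝ} (h0 : 0 < ε) (h1 : ε ≤ 1 / 2) (hR : 0 ≤ R)
    (hR1 : R ≤ 1) (hεR : 1 + Real.logb 2 (1 - ε) ≤ R) (C : LinearCode n)
    (hP : 0 < undetectedErrorProb ε (codewords C)) :
    Real.logb 2 (undetectedErrorProb ε (codewords C)) ≤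
      Module.finrank (ZMod 2) C - n
        + subsetExpectation R (fun T => (T.card : ℝ) - (columnRank C T : ℝ)) := by
  have hkey := logb_relativeDensity_le h0 h1 hR hR1 hεR univ C
  rw [powersetExpectation_univ] at hkey
  have hpos := sum_partialBscProb_pos h0 (by linarith) C univ
  have hle : undetectedErrorProb ε (codewords C)
      ≤ ∑ x ∈ codewords C, partialBscProb univ ε x 0 := by
    rw [undetectedErrorProb_codewords]
    exact sum_le_sum_of_subset_of_nonneg (erase_subset _ _)
      fun _ _ _ => partialBscProb_nonneg h0.le (by linarith) _ _ _
  have hlog := Real.logb_le_logb_of_le (b := 2) (by norm_num) hP hle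
  rw [relativeDensity, card_codewords, Finset.card_fin, Real.logb_mul (by positivity) hpos.ne',
    Real.logb_div (by positivity) (by positivity)] at hkey
  push_cast at hkey
  rw [Real.logb_pow, Real.logb_pow, Real.logb_self_eq_one (by norm_num)] at hkey
  linarith

theorem eventually_exponent_of_isPseudorandom {ε R : ℝ} (h0 : 0 < ε) (h1 : ε < 1 / 2)
    (hR : 0 ≤ R) (hR1 : R ≤ 1) (hεR : 1 + Real.logb 2 (1 - ε) ≤ R) {n : ℕ → ℕ}
    {C : ∀ k, LinearCode (n k)} (hC : IsPseudorandom R n C) {η : ℝ} (hη : 0 < η) :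
    ∀ᶠ k in atTop, 0 < undetectedErrorProb ε (codewords (C k)) ∧
      1 - R - η ≤ undetectedErrorExponent ε (codewords (C k)) ∧
      undetectedErrorExponent ε (codewords (C k)) ≤ 1 - R + η := by
  obtain ⟨δ, hδ, hup⟩ := exists_eventually_undetectedErrorExponent_le h0 h1 hεR hη
  filter_upwards [hC.length_tendsto.eventually hup,
    hC.length_tendsto.eventually (eventually_gt_atTop 0),
    hC.rate_tendsto.eventually (lt_mem_nhds (by linarith : R - δ < R)),
    hC.rate_tendsto.eventually (gt_mem_nhds (by linarith : R < R + η / 2)),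
    hC.deficiency_isLittleO.bound (by linarith : 0 < η / 2)] with k hk hn hr1 hr2 hdef
  have hn' : (0 : ℝ) < n k := by exact_mod_cast hn
  rw [rate, lt_div_iff₀ hn'] at hr1
  rw [rate, div_lt_iff₀ hn'] at hr2
  obtain ⟨hP, hle⟩ := hk (codewords (C k)) (by
    rw [card_codewords]
    push_cast
    rw [← Real.rpow_natCast]
    exact Real.rpow_le_rpow_of_exponent_le (by norm_num) hr1.le)
  refine ⟨hP, ?_, hle⟩
  have hlog := logb_undetectedErrorProb_le h0 h1.le hR hR1 hεR (C k) hP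
  rw [Real.norm_eq_abs, Real.norm_eq_abs, Nat.abs_cast] at hdef
  have hd := (abs_le.1 hdef).2
  rw [undetectedErrorExponent, neg_mul, le_neg, one_div, ← div_eq_inv_mul, div_le_iff₀ hn']
  -- Half of `η` absorbs the deviation of the rate from `R`, the other half the rank deficiency.
  nlinarith

/-! ### Concentration for random codes -/

/-- Markov's inequality for a uniformly random element of a finite set. -/
theorem one_sub_le_uniformProb {α : Type*} {s : Finset α} (hs : s.Nonempty) {f : α → ℝ}
    {p : α → Prop} {A t : ℝ} (hf : ∀ a ∈ s, 0 ≤ f a) (ht : 0 < t)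
    (hA : ∑ a ∈ s, f a ≤ A * s.card) (hp : ∀ a ∈ s, f a ≤ t → p a) :
    1 - A / t ≤ uniformProb s p := by
  classical
  have hs' : (0 : ℝ) < s.card := by exact_mod_cast hs.card_pos
  have hc : ((s.filter p).card : ℝ) + (s.filter (fun a => ¬ p a)).card = s.card := by
    exact_mod_cast card_filter_add_card_filter_not (s := s) p
  have hm : t * (s.filter (fun a => ¬ p a)).card ≤ A * s.card := by
    refine le_trans ?_ hA
    refine le_trans ?_ (sum_le_sum_of_subset_of_nonneg (filter_subset (fun a => ¬ p a) s)
      fun a ha _ => hf a ha)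
    rw [mul_comm, ← nsmul_eq_mul]
    refine card_nsmul_le_sum _ _ _ fun a ha => ?_
    by_contra! hlt
    exact (mem_filter.1 ha).2 (hp a (mem_filter.1 ha).1 hlt.le)
  have e : uniformProb s p = ((s.filter p).card : ℝ) / s.card := by
    rw [uniformProb]
  rw [e, le_div_iff₀ hs', sub_mul, one_mul, sub_le_iff_le_add, ← hc, add_le_add_iff_left, hc,
    div_mul_eq_mul_div, le_div_iff₀ ht]
  linarith

theorem uniformProb_le_one {α : Type*} (s : Finset α) (p : α → Prop) : uniformProb s p ≤ 1 := by
  classical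
  unfold uniformProb
  refine div_le_one_of_le₀ (Nat.cast_le.2 (card_le_card ?_)) (by positivity)
  exact filter_subset _ s

/-- A random code of rate at least `R` whose undetected error probability has mean at most
`2 ^ (-(1 - R) n)`, up to a constant, has undetected error exponent `1 - R`. -/
theorem tendsto_uniformProb_exponent {ε R : ℝ} (h0 : 0 < ε) (h1 : ε < 1 / 2)
    (hεR : 1 + Real.logb 2 (1 - ε) ≤ R) {α : ℕ → Type*} {s : ∀ n, Finset (α n)}
    {F : ∀ n, α n → Finset (Cube n)} (hs : ∀ n, (s n).Nonempty)
    (hF : ∀ n, ∀ a ∈ s n, (2 : ℝ) ^ (R * n) ≤ (F n a).card)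
    (hmean : ∀ᶠ n : ℕ in atTop, ∑ a ∈ s n, undetectedErrorProb ε (F n a)
      ≤ 2 * 2 ^ (-((1 - R) * n)) * (s n).card) {δ : ℝ} (hδ : 0 < δ) :
    Tendsto (fun n : ℕ => uniformProb (s n)
      (fun a => |undetectedErrorExponent ε (F n a) - (1 - R)| ≤ δ)) atTop (𝓝 1) := by
  obtain ⟨δ', hδ', hup⟩ := exists_eventually_undetectedErrorExponent_le h0 h1 hεR hδ
  have hlim : Tendsto (fun n : ℕ => 1 - 2 * ((2 : ℝ) ^ (-δ)) ^ n) atTop (𝓝 1) := by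
    have hlt : (2 : ℝ) ^ (-δ) < 1 := Real.rpow_lt_one_of_one_lt_of_neg (by norm_num) (by linarith)
    have := (tendsto_pow_atTop_nhds_zero_of_lt_one (by positivity) hlt).const_mul 2
    simpa using this.const_sub 1
  refine tendsto_of_tendsto_of_tendsto_of_le_of_le' hlim tendsto_const_nhds ?_
    (Eventually.of_forall fun n => uniformProb_le_one _ _)
  filter_upwards [hup, hmean, eventually_gt_atTop 0] with n hn hm hn0
  have ht : (0 : ℝ) < 2 ^ (-((1 - R - δ) * n)) := by positivity
  refine le_trans (le_of_eq ?_) (one_sub_le_uniformProb (hs n)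
    (fun a _ => undetectedErrorProb_nonneg h0 (by linarith) (F n a)) ht hm ?_)
  -- Mean over threshold equals `2 * 2 ^ (-δ n)`, which bounds the failure probability.
  · rw [mul_div_assoc, ← Real.rpow_sub (by norm_num), ← Real.rpow_natCast,
      ← Real.rpow_mul (by norm_num)]
    congr 3; ring
  · intro a ha hle
    obtain ⟨hP, hexp⟩ := hn (F n a) (le_trans
      (Real.rpow_le_rpow_of_exponent_le (by norm_num) (by nlinarith [n.cast_nonneg (α := ℝ)]))
      (hF n a ha))
    have := neg_inv_mul_logb_ge_of_le hn0 hP hle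
    rw [← undetectedErrorExponent] at this
    rw [abs_le]
    constructor <;> linarith

/-! ### Mean undetected error probabilities -/

theorem sum_bscProb_univ (ε : ℝ) (x : Cube n) : ∑ y : Cube n, bscProb ε x y = 1 := by
  simp only [bscProb_eq_partialBscProb, partialBscProb]
  have h := Finset.prod_univ_sum (fun _ : Fin n => (univ : Finset (ZMod 2)))
    (fun i z => if x i = z then 1 - ε else ε)
  rw [Fintype.piFinset_univ] at h
  rw [← h]
  refine prod_eq_one fun i _ => ?_
  have key : ∀ s : ZMod 2, ∑ z : ZMod 2, (if s = z then 1 - ε else ε) = 1 := by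
    intro s
    rw [show (univ : Finset (ZMod 2)) = {0, 1} from rfl, sum_pair (by decide)]
    rcases (by decide : ∀ s : ZMod 2, s = 0 ∨ s = 1) s with rfl | rfl <;> simp
  exact key _

/-- Double count the `M`-subsets of an `N`-set together with an ordered pair of distinct elements.
-/
theorem choose_mul_mul (N M : ℕ) (hM : 2 ≤ M) (hN : M ≤ N) :
    N.choose M * (M * (M - 1)) = N * (N - 1) * (N - 2).choose (M - 2) := by
  obtain ⟨m, rfl⟩ := Nat.exists_eq_add_of_le' hM
  obtain ⟨k, rfl⟩ := Nat.exists_eq_add_of_le' (hM.trans hN)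
  have e1 := Nat.add_one_mul_choose_eq (k + 1) (m + 1)
  have e2 := Nat.add_one_mul_choose_eq k m
  simp only [Nat.add_sub_cancel, show ∀ j : ℕ, j + 2 - 1 = j + 1 from fun _ => rfl]
  calc _ = (k + 1 + 1).choose (m + 1 + 1) * (m + 1 + 1) * (m + 1) := by ring
    _ = (k + 1 + 1) * ((k + 1).choose (m + 1) * (m + 1)) := by rw [← e1]; ring
    _ = _ := by rw [← e2]; ring

/-- The mean undetected error probability of a uniformly random code with `M` codewords. -/
theorem sum_powersetCard_undetectedErrorProb_le {ε : ℝ} (h0 : 0 < ε) (h1 : ε < 1) {M : ℕ}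
    (hM : 2 ≤ M) (hMn : M ≤ 2 ^ n) :
    ∑ C ∈ powersetCard M (univ : Finset (Cube n)), undetectedErrorProb ε C
      ≤ M / 2 ^ n * (powersetCard M (univ : Finset (Cube n))).card := by
  classical
  have hN : (univ : Finset (Cube n)).card = 2 ^ n := by simp
  have hpair : ∀ x y : Cube n, y ≠ x →
      ((powersetCard M (univ : Finset (Cube n))).filter (fun C => x ∈ C ∧ y ∈ C)).card
        = (2 ^ n - 2).choose (M - 2) := by
    intro x y hxy
    have hc : ({x, y} : Finset (Cube n)).card = 2 := card_pair hxy.symm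
    have := card_filter_powersetCard_subset {x, y} (univ : Finset (Cube n)) M (subset_univ _)
      (by rw [hc]; exact hM)
    rw [hN, hc] at this
    rw [← this]
    congr 1
    refine filter_congr fun C _ => ?_
    simp [insert_subset_iff]
  have hsum : ∑ C ∈ powersetCard M (univ : Finset (Cube n)), undetectedErrorProb ε C
      = 1 / M * ((2 ^ n - 2).choose (M - 2) * ∑ x : Cube n, ∑ y ∈ univ.erase x, bscProb ε x y) := by
    have e : ∀ C ∈ powersetCard M (univ : Finset (Cube n)), undetectedErrorProb ε C
        = 1 / M * ∑ x : Cube n, ∑ y ∈ univ.erase x,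
            if x ∈ C ∧ y ∈ C then bscProb ε x y else 0 := by
      intro C hC
      rw [undetectedErrorProb, (mem_powersetCard.1 hC).2]
      congr 1
      have hsub : ∑ x ∈ C, ∑ y ∈ univ.erase x, (if x ∈ C ∧ y ∈ C then bscProb ε x y else 0)
          = ∑ x : Cube n, ∑ y ∈ univ.erase x, if x ∈ C ∧ y ∈ C then bscProb ε x y else 0 :=
        by
        refine sum_subset (subset_univ C) fun x _ hx => sum_eq_zero fun y _ => ?_
        exact if_neg fun h => hx h.1
      rw [← hsub]
      refine sum_congr rfl fun x hx => ?_
      rw [← sum_filter]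
      refine sum_congr ?_ fun _ _ => rfl
      ext y
      simp [hx]
    rw [sum_congr rfl e, ← mul_sum]
    congr 1
    rw [sum_comm, mul_sum]
    refine sum_congr rfl fun x _ => ?_
    rw [sum_comm, mul_sum]
    refine sum_congr rfl fun y hy => ?_
    rw [← sum_filter, sum_const, hpair x y (ne_of_mem_erase hy), nsmul_eq_mul]
  have hle : ∑ x : Cube n, ∑ y ∈ univ.erase x, bscProb ε x y ≤ 2 ^ n := by
    calc _ ≤ ∑ x : Cube n, ∑ y : Cube n, bscProb ε x y :=
          sum_le_sum fun x _ => sum_le_sum_of_subset_of_nonneg (erase_subset _ _)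
            fun _ _ _ => (bscProb_pos h0 h1 _ _).le
      _ = 2 ^ n := by simp [sum_bscProb_univ]
  have hid := choose_mul_mul (2 ^ n) M hM hMn
  rw [hsum, card_powersetCard, hN]
  have hidR : (((2 ^ n).choose M : ℕ) : ℝ) * (M * (M - 1))
      = 2 ^ n * (2 ^ n - 1) * ((2 ^ n - 2).choose (M - 2) : ℕ) := by
    have := congrArg (Nat.cast (R := ℝ)) hid
    push_cast [Nat.cast_sub (show 1 ≤ M by omega), Nat.cast_sub (Nat.one_le_two_pow (n := n))]
      at this
    exact this
  have hMR : (2 : ℝ) ≤ M := by exact_mod_cast hM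
  have hMN : (M : ℝ) ≤ 2 ^ n := by exact_mod_cast hMn
  set N : ℝ := 2 ^ n
  set A : ℝ := (((2 ^ n).choose M : ℕ) : ℝ)
  set B : ℝ := (((2 ^ n - 2).choose (M - 2) : ℕ) : ℝ)
  have hA : 0 ≤ A := Nat.cast_nonneg _
  have hB : 0 ≤ B := Nat.cast_nonneg _
  calc _ ≤ 1 / M * (B * N) := by gcongr
    _ = A * (M - 1) / (N - 1) := by
        rw [eq_div_iff (by linarith), div_mul_eq_mul_div, one_mul, div_mul_eq_mul_div,
          div_eq_iff (by linarith)]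
        linarith
    -- `(M - 1) / (N - 1) ≤ M / N` because `M ≤ N`.
    _ ≤ M / N * A := by
        rw [div_mul_eq_mul_div, div_le_div_iff₀ (by linarith) (by linarith)]
        nlinarith

/-- Pick `i` with `c i = 1`. Adding `y` to column `i` of a matrix that kills `c` gives one that
sends `c` to `y`, so the pair of `y` and the original matrix can be recovered. -/
theorem two_pow_mul_card_filter_mulVec_le {m : ℕ} {c : Cube n} (hc : c ≠ 0) :
    2 ^ m * ((univ : Finset (Matrix (Fin m) (Fin n) (ZMod 2))).filter
        (fun H => H.mulVec c = 0)).card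
      ≤ (univ : Finset (Matrix (Fin m) (Fin n) (ZMod 2))).card := by
  classical
  obtain ⟨i, hi⟩ := Function.ne_iff.1 hc
  have hm : (univ : Finset (Cube m)).card = 2 ^ m := by simp
  have key : ∀ s : ZMod 2, s ≠ 0 → s = 1 := by decide
  have hi1 : c i = 1 := key _ hi
  rw [← hm, ← card_product]
  refine card_le_card_of_injOn (fun p => p.2 + Matrix.vecMulVec p.1 (Pi.single i 1))
    (fun _ _ => by simp) ?_
  have hval : ∀ p : Cube m × Matrix (Fin m) (Fin n) (ZMod 2), p.2.mulVec c = 0 →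
      (p.2 + Matrix.vecMulVec p.1 (Pi.single i 1)).mulVec c = p.1 := by
    intro p hp
    rw [Matrix.add_mulVec, hp, zero_add, Matrix.vecMulVec_mulVec]
    simp [hi1]
  rintro ⟨y, H⟩ hp ⟨y', H'⟩ hp' h
  simp only [coe_product, Set.mem_prod, mem_coe, mem_filter, mem_univ, true_and] at hp hp' h
  have hy : y = y' := (hval (y, H) hp).symm.trans
    ((congrArg (fun X => X.mulVec c) h).trans (hval (y', H') hp'))
  subst hy
  rw [add_left_inj] at h
  rw [h]

theorem mem_parityCheckCode {m : ℕ} {H : Matrix (Fin m) (Fin n) (ZMod 2)} {c : Cube n} :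
    c ∈ parityCheckCode H ↔ H.mulVec c = 0 := by
  simp [parityCheckCode]

/-- The mean undetected error probability of a linear code with `m` random parity checks. -/
theorem sum_parityCheckCode_undetectedErrorProb_le {ε : ℝ} (h0 : 0 < ε) (h1 : ε < 1) (m : ℕ) :
    ∑ H : Matrix (Fin m) (Fin n) (ZMod 2), undetectedErrorProb ε (codewords (parityCheckCode H))
      ≤ (2 ^ m)⁻¹ * (univ : Finset (Matrix (Fin m) (Fin n) (ZMod 2))).card := by
  classical
  have e : ∀ H : Matrix (Fin m) (Fin n) (ZMod 2),
      undetectedErrorProb ε (codewords (parityCheckCode H))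
        = ∑ c ∈ univ.erase (0 : Cube n),
            if H.mulVec c = 0 then bscProb ε 0 c else 0 := by
    intro H
    rw [undetectedErrorProb_codewords, ← sum_filter]
    refine sum_congr ?_ fun c _ => ?_
    · ext c; simp [mem_parityCheckCode]
    · rw [bscProb_eq_partialBscProb]; simp [partialBscProb, eq_comm]
  simp only [e]
  rw [sum_comm]
  set A : ℝ := ((univ : Finset (Matrix (Fin m) (Fin n) (ZMod 2))).card : ℝ)
  calc _ ≤ ∑ c ∈ univ.erase (0 : Cube n), (2 ^ m)⁻¹ * A * bscProb ε 0 c := by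
        refine sum_le_sum fun c hc => ?_
        rw [← sum_filter, sum_const, nsmul_eq_mul]
        refine mul_le_mul_of_nonneg_right ?_ (bscProb_pos h0 h1 _ _).le
        rw [← div_eq_inv_mul, le_div_iff₀ (by positivity), mul_comm]
        simp only [A]
        exact_mod_cast two_pow_mul_card_filter_mulVec_le (m := m) (ne_of_mem_erase hc)
    _ ≤ ∑ c : Cube n, (2 ^ m)⁻¹ * A * bscProb ε 0 c :=
        sum_le_sum_of_subset_of_nonneg (erase_subset _ _)
          fun _ _ _ => mul_nonneg (by positivity) (bscProb_pos h0 h1 _ _).le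
    _ = _ := by rw [← mul_sum, sum_bscProb_univ, mul_one]

theorem two_rpow_le_card_parityCheckCode {R : ℝ} (hR1 : R ≤ 1)
    (H : Matrix (Fin ⌊(1 - R) * (n : ℝ)⌋₊) (Fin n) (ZMod 2)) :
    (2 : ℝ) ^ (R * n) ≤ (codewords (parityCheckCode H)).card := by
  have h := LinearMap.finrank_range_add_finrank_ker H.mulVecLin
  have hr := Submodule.finrank_le (LinearMap.range H.mulVecLin)
  rw [Module.finrank_fin_fun] at h hr
  have hfl := Nat.floor_le (mul_nonneg (sub_nonneg.2 hR1) (n.cast_nonneg (α := ℝ)))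
  rw [card_codewords, parityCheckCode]
  push_cast
  rw [← Real.rpow_natCast]
  refine Real.rpow_le_rpow_of_exponent_le (by norm_num) ?_
  have h' : ((Module.finrank (ZMod 2) (LinearMap.range H.mulVecLin) : ℕ) : ℝ)
      + (Module.finrank (ZMod 2) (LinearMap.ker H.mulVecLin) : ℕ) = n := by exact_mod_cast h
  have hr' : ((Module.finrank (ZMod 2) (LinearMap.range H.mulVecLin) : ℕ) : ℝ)
      ≤ ⌊(1 - R) * (n : ℝ)⌋₊ := by exact_mod_cast hr
  linarith

theorem ceil_two_rpow_le {R : ℝ} (hR1 : R ≤ 1) (n : ℕ) : ⌈(2 : ℝ) ^ (R * (n : ℝ))⌉₊ ≤ 2 ^ n := by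
  rw [Nat.ceil_le]
  push_cast
  rw [← Real.rpow_natCast]
  exact Real.rpow_le_rpow_of_exponent_le (by norm_num)
    (mul_le_of_le_one_left (Nat.cast_nonneg n) hR1)

theorem codesOfRate_nonempty {R : ℝ} (hR1 : R ≤ 1) (n : ℕ) : (codesOfRate R n).Nonempty := by
  rw [codesOfRate, powersetCard_nonempty]
  simpa using ceil_two_rpow_le hR1 n

theorem two_rpow_le_card_of_mem_codesOfRate {R : ℝ} {C : Finset (Cube n)}
    (hC : C ∈ codesOfRate R n) : (2 : ℝ) ^ (R * n) ≤ C.card := by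
  rw [(mem_powersetCard.1 hC).2]
  exact Nat.le_ceil _

theorem sum_codesOfRate_undetectedErrorProb_le {ε R : ℝ} (h0 : 0 < ε) (h1 : ε < 1)
    (hR : 0 < R) (hR1 : R ≤ 1) (hn : 0 < n) :
    ∑ C ∈ codesOfRate R n, undetectedErrorProb ε C
      ≤ 2 * 2 ^ (-((1 - R) * n)) * (codesOfRate R n).card := by
  have hn' : (0 : ℝ) < n := by exact_mod_cast hn
  -- Strictness forces at least two codewords, as the pair count requires.
  have h1lt : (1 : ℝ) < 2 ^ (R * n) := Real.one_lt_rpow (by norm_num) (by positivity)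
  refine (sum_powersetCard_undetectedErrorProb_le h0 h1 (Nat.lt_ceil.2 (by simpa using h1lt))
    (ceil_two_rpow_le hR1 n)).trans ?_
  refine mul_le_mul_of_nonneg_right ?_ (Nat.cast_nonneg _)
  rw [div_le_iff₀ (by positivity), mul_assoc, ← Real.rpow_natCast,
    ← Real.rpow_add (by norm_num)]
  have e : -((1 - R) * n) + n = R * n := by ring
  rw [e]
  have := Nat.ceil_lt_add_one (by positivity : 0 ≤ (2 : ℝ) ^ (R * n))
  linarith

/-! ### The best exponent -/

theorem exists_minUndetectedErrorProb_eq {ε R : ℝ} (hR1 : R ≤ 1) (n : ℕ) :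
    ∃ C ∈ codesOfRate R n, undetectedErrorProb ε C = minUndetectedErrorProb R ε n ∧
      ∀ C' ∈ codesOfRate R n, undetectedErrorProb ε C ≤ undetectedErrorProb ε C' := by
  obtain ⟨C, hC, hmin⟩ :=
    (codesOfRate R n).exists_min_image (undetectedErrorProb ε) (codesOfRate_nonempty hR1 n)
  refine ⟨C, hC, ?_, hmin⟩
  symm
  refine IsLeast.csInf_eq ⟨⟨C, hC, rfl⟩, ?_⟩
  rintro _ ⟨C', hC', rfl⟩
  exact hmin C' hC'

theorem tendsto_minUndetectedErrorProb {ε R : ℝ} (h0 : 0 < ε) (h1 : ε < 1 / 2) (hR : 0 < R)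
    (hR1 : R ≤ 1) (hεR : 1 + Real.logb 2 (1 - ε) ≤ R) :
    Tendsto (fun n : ℕ => -(1 / (n : ℝ)) * Real.logb 2 (minUndetectedErrorProb R ε n)) atTop
      (𝓝 (1 - R)) := by
  rw [Metric.tendsto_nhds]
  intro η' hη'
  set η := η' / 2 with hη
  have hηpos : 0 < η := by positivity
  obtain ⟨δ, hδ, hup⟩ := exists_eventually_undetectedErrorExponent_le h0 h1 hεR hηpos
  filter_upwards [hup, eventually_gt_atTop 0,
    tendsto_natCast_atTop_atTop.eventually_ge_atTop (1 / η)] with n hn hn0 hnη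
  rw [div_le_iff₀ hηpos] at hnη
  obtain ⟨C, hC, hCeq, hCmin⟩ := exists_minUndetectedErrorProb_eq (ε := ε) hR1 n
  obtain ⟨hP, hexp⟩ := hn C (le_trans
      (Real.rpow_le_rpow_of_exponent_le (by norm_num) (by nlinarith [n.cast_nonneg (α := ℝ)]))
      (two_rpow_le_card_of_mem_codesOfRate hC))
  have hmean := sum_codesOfRate_undetectedErrorProb_le h0 (by linarith) hR hR1 hn0 (ε := ε)
  have hcard : (0 : ℝ) < (codesOfRate R n).card := by
    exact_mod_cast (codesOfRate_nonempty hR1 n).card_pos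
  have hPle : undetectedErrorProb ε C ≤ 2 * 2 ^ (-((1 - R) * n)) := by
    have h := card_nsmul_le_sum _ _ _ hCmin
    rw [nsmul_eq_mul, mul_comm] at h
    exact le_of_mul_le_mul_right (h.trans hmean) hcard
  -- The factor `2` in the mean costs `1 / n ≤ η` in the exponent.
  have hlow := neg_inv_mul_logb_ge_of_le (b := 1 - R - η) hn0 hP (hPle.trans (by
    calc (2 : ℝ) * 2 ^ (-((1 - R) * n)) = 2 ^ (1 + -((1 - R) * n)) := by
          rw [Real.rpow_add (by norm_num), Real.rpow_one]
      _ ≤ _ := Real.rpow_le_rpow_of_exponent_le (by norm_num) (by linarith)))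
  rw [undetectedErrorExponent] at hexp
  rw [← hCeq, Real.dist_eq, abs_lt]
  constructor <;> linarith

theorem bestUndetectedErrorExponent_eq {ε R : ℝ} (h0 : 0 < ε) (h1 : ε < 1 / 2) (hR : 0 < R)
    (hR1 : R ≤ 1) (hεR : 1 + Real.logb 2 (1 - ε) ≤ R) :
    bestUndetectedErrorExponent R ε = ((1 - R : ℝ) : EReal) :=
  ((continuous_coe_real_ereal.tendsto _).comp
    (tendsto_minUndetectedErrorProb h0 h1 hR hR1 hεR)).liminf_eq

end BinaryCode

end

theorem corollary1p5 (ε R : ℝ) (hε : 0 < ε) (hε' : ε < 1 / 2) (hR : 0 < R) (hR' : R < 1)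
    (hεR : 1 + Real.logb 2 (1 - ε) ≤ R) :
    -- the undetected error exponent of pseudorandom linear codes of rate `R` is at least
    -- `1 - R` up to lower order terms, and in fact it converges to `1 - R`
    (∀ (n : ℕ → ℕ) (C : ∀ k, BinaryCode.LinearCode (n k)),
      BinaryCode.IsPseudorandom R n C →
        (∀ δ : ℝ, 0 < δ → ∀ᶠ k in atTop,
          0 < BinaryCode.undetectedErrorProb ε (BinaryCode.codewords (C k)) ∧
          1 - R - δ ≤
            BinaryCode.undetectedErrorExponent ε (BinaryCode.codewords (C k))) ∧
        Tendsto
          (fun k => BinaryCode.undetectedErrorExponent ε (BinaryCode.codewords (C k)))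
          atTop (𝓝 (1 - R))) ∧
    -- this is the best asymptotic exponent over all codes of rate `R`
    BinaryCode.bestUndetectedErrorExponent R ε = ((1 - R : ℝ) : EReal) ∧
    -- with high probability it is the exponent of a random code with `⌈2 ^ (R n)⌉` codewords
    (∀ δ : ℝ, 0 < δ →
      Tendsto (fun n : ℕ =>
        BinaryCode.uniformProb (BinaryCode.codesOfRate R n)
          (fun C => |BinaryCode.undetectedErrorExponent ε C - (1 - R)| ≤ δ))
        atTop (𝓝 1)) ∧
    -- and that of a random linear code with `⌊(1 - R) n⌋` parity checks
    (∀ δ : ℝ, 0 < δ →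
      Tendsto (fun n : ℕ =>
        BinaryCode.uniformProb
          (Finset.univ : Finset (Matrix (Fin ⌊(1 - R) * (n : ℝ)⌋₊) (Fin n) (ZMod 2)))
          (fun M => |BinaryCode.undetectedErrorExponent ε
            (BinaryCode.codewords (BinaryCode.parityCheckCode M)) - (1 - R)| ≤ δ))
        atTop (𝓝 1)) := by
  have hε1 : ε < 1 := by linarith
  refine ⟨fun n C hC => ⟨fun δ hδ => ?_, ?_⟩,
    BinaryCode.bestUndetectedErrorExponent_eq hε hε' hR hR'.le hεR, fun δ hδ => ?_, fun δ hδ => ?_⟩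
  · filter_upwards [BinaryCode.eventually_exponent_of_isPseudorandom hε hε' hR.le hR'.le hεR hC hδ]
      with k hk
    exact ⟨hk.1, hk.2.1⟩
  · rw [Metric.tendsto_nhds]
    intro δ hδ
    filter_upwards [BinaryCode.eventually_exponent_of_isPseudorandom hε hε' hR.le hR'.le hεR hC
      (half_pos hδ)] with k hk
    rw [Real.dist_eq, abs_lt]
    constructor <;> linarith [hk.2.1, hk.2.2]
  · refine BinaryCode.tendsto_uniformProb_exponent hε hε' hεR (F := fun _ C => C)
      (BinaryCode.codesOfRate_nonempty hR'.le)
      (fun n C hC => BinaryCode.two_rpow_le_card_of_mem_codesOfRate hC) ?_ hδ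
    filter_upwards [eventually_gt_atTop 0] with n hn
    exact BinaryCode.sum_codesOfRate_undetectedErrorProb_le hε hε1 hR hR'.le hn
  · refine BinaryCode.tendsto_uniformProb_exponent hε hε' hεR
      (F := fun _ M => BinaryCode.codewords (BinaryCode.parityCheckCode M))
      (fun n => univ_nonempty)
      (fun n M _ => BinaryCode.two_rpow_le_card_parityCheckCode hR'.le M)
      (Eventually.of_forall fun n => ?_) hδ
    refine (BinaryCode.sum_parityCheckCode_undetectedErrorProb_le hε hε1 _).trans ?_
    refine mul_le_mul_of_nonneg_right ?_ (Nat.cast_nonneg _)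
    -- Rounding down loses less than one parity check, hence at most the factor `2` allowed in the
    -- mean.
    have hfl := Nat.lt_floor_add_one ((1 - R) * (n : ℝ))
    rw [← Real.rpow_natCast, ← Real.rpow_neg (by norm_num)]
    calc (2 : ℝ) ^ (-(⌊(1 - R) * (n : ℝ)⌋₊ : ℝ)) ≤ 2 ^ (1 + -((1 - R) * n)) :=
          Real.rpow_le_rpow_of_exponent_le (by norm_num) (by linarith)
      _ = 2 * 2 ^ (-((1 - R) * n)) := by
          rw [Real.rpow_add (by norm_num), Real.rpow_one]
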